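/- Let $\mathbb K=\mathbb R$ or $\mathbb C$. For Banach spaces $X,Y$ over $\mathbb K$, $L(X,Y)$ is the space of bounded linear operators with the operator norm, $B_Z$ is the closed unit ball of a normed space $Z$, and $\overline{\mathrm{conv}}$ is the norm-closed (real) convex hull. An operator $G\in L(X,Y)$ with $\|G\|=1$ is *generating* if $$\inf_{\delta>0}\ \sup\{\|Tx\| : x\in X,\ \|x\|=1,\ \|Gx\|>1-\delta\}=\|T\|\qquad\text{for every } T\in L(X,Y),$$ and $\mathrm{Gen}(X,Y)$ is the set of generating operators. An operator $T\in L(L_1(\mu),Y)$ is *representable* if there is $g\in L_\infty(\mu,Y)$ such that $T(f)=\int_\Omega f(t)g(t)\,d\mu(t)$ for all $f\in L_1(\mu)$, where $L_1(\mu)$ consists of $\mathbb K$-valued functions. A Banach space $Y$ has the *Radon–Nikodým property* (RNP) if every nonempty closed convex bounded set $C\subseteq Y$ has a denting point, that is, a point $x\in C$ such that $x\notin\overline{\mathrm{conv}}(C\setminus B(x,\delta))$ for every $\delta>0$, where $B(x,\delta)$ is the open ball. Let $Y\neq\{0\}$ be a Banach space over $\mathbb K$. 1. Let $(\Omega,\Sigma,\mu)$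 be a finite measure space with $\mu\neq0$. Then $$\{T\in L(L_1(\mu),Y) : \|T\|\le 1,\ T\text{ is representable}\}\subseteq\overline{\mathrm{conv}}\big(\mathrm{Gen}(L_1(\mu),Y)\big).$$ If moreover $Y$ has the RNP, then $$B_{L(L_1(\mu),Y)}=\overline{\mathrm{conv}}\big(\mathrm{Gen}(L_1(\mu),Y)\big).$$ 2. Let $(\Omega,\Sigma,\mu)$ be an arbitrary (positive) measure space. Then $$B_{L_\infty(\mu,Y)}=\overline{\mathrm{conv}}\big(\{g\in L_\infty(\mu,Y) : \|g(t)\|=1\ \text{for } \mu\text{-almost every } t\}\big).$$ -/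

import Mathlib

open MeasureTheory Metric
open scoped ENNReal

noncomputable section

namespace GeneratingOperators

section Generating

variable {𝕜 X Y Z : Type*} [RCLike 𝕜]
  [NormedAddCommGroup X] [NormedSpace 𝕜 X]
  [NormedAddCommGroup Y] [NormedSpace 𝕜 Y]
  [NormedAddCommGroup Z] [NormedSpace 𝕜 Z]

/-- The `δ`-attainment set `att(G, δ) = {x ∈ S_X : ‖G x‖ > 1 - δ}`. -/
def att (G : X →L[𝕜] Y) (δ : ℝ) : Set X :=
  {x | ‖x‖ = 1 ∧ 1 - δ < ‖G x‖}

/-- `‖T‖_{G,δ} = sup {‖T x‖ : x ∈ att(G, δ)}`. For `‖G‖ = 1` and `δ > 0` the supremum is over a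
nonempty set bounded above by `‖T‖`. -/
def relNormAt (G : X →L[𝕜] Y) (δ : ℝ) (T : X →L[𝕜] Z) : ℝ :=
  sSup ((fun x => ‖T x‖) '' att G δ)

/-- The (semi-)norm of `T` relative to `G`: `‖T‖_G = inf_{δ > 0} ‖T‖_{G,δ}`. -/
def relNorm (G : X →L[𝕜] Y) (T : X →L[𝕜] Z) : ℝ :=
  ⨅ δ : Set.Ioi (0 : ℝ), relNormAt G (δ : ℝ) T

/-- A norm-one operator `G : X → Y` is generating if `‖T‖_G = ‖T‖` for every bounded linear
operator `T : X → Y`. -/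
def IsGenerating (G : X →L[𝕜] Y) : Prop :=
  ‖G‖ = 1 ∧ ∀ T : X →L[𝕜] Y, relNorm G T = ‖T‖

variable (𝕜 X Y) in
/-- The set `Gen(X, Y)` of all generating operators from `X` to `Y`. -/
def Gen : Set (X →L[𝕜] Y) := {G | IsGenerating G}

end Generating

section Representable

variable {Ω : Type*} [MeasurableSpace Ω] {μ : Measure Ω}
  {𝕜 Y : Type*} [RCLike 𝕜] [NormedAddCommGroup Y] [NormedSpace ℝ Y] [NormedSpace 𝕜 Y]

/-- An operator `T : L₁(μ) → Y` is representable if there is `g ∈ L_∞(μ, Y)` such that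
`T f = ∫ f(t) g(t) dμ(t)` for all `f ∈ L₁(μ)` (the integrand is always Bochner integrable). -/
def IsRepresentable (T : Lp 𝕜 1 μ →L[𝕜] Y) : Prop :=
  ∃ g : Lp Y ∞ μ, ∀ f : Lp 𝕜 1 μ, T f = ∫ t, f t • g t ∂μ

variable (μ 𝕜 Y) in
/-- The set of representable operators in the unit ball of `L(L₁(μ), Y)`. -/
def representableBall : Set (Lp 𝕜 1 μ →L[𝕜] Y) :=
  {T | ‖T‖ ≤ 1 ∧ IsRepresentable T}

end Representable

section RNP

variable {Y : Type*} [NormedAddCommGroup Y] [NormedSpace ℝ Y]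

/-- `x` is a denting point of `A` if `x ∈ A` and, for every `δ > 0`, `x` is not in the closed
convex hull of `A \ B(x, δ)`. -/
def IsDentingPoint (A : Set Y) (x : Y) : Prop :=
  x ∈ A ∧ ∀ δ : ℝ, 0 < δ → x ∉ closure (convexHull ℝ (A \ ball x δ))

variable (Y) in
/-- The Radon-Nikodým property of a Banach space, in its geometric form: every nonempty closed
convex bounded subset has a denting point. -/
def HasRNP : Prop :=
  ∀ C : Set Y, C.Nonempty → IsClosed C → Convex ℝ C → Bornology.IsBounded C →
    ∃ x, IsDentingPoint C x

end RNP

end GeneratingOperators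

end

/-! The argument localises to small sets. By Hahn decomposition, an operator on `L₁(μ)` has norm at
most `K` once every non-null set contains a non-null set where its average is at most `K` in norm
(`norm_apply_le_of_exists_subset`). If `‖g‖ = 1` a.e., then `g` is nearly constant on small sets, so
their normalised indicators lie in the attainment sets of `f ↦ ∫ f g`, and this operator is
generating.

The map from densities to operators is a linear isometry, so the claim on representable operators
follows from the one on `L_∞(μ, Y)`. There `g = ‖g‖ u` with `u` unimodular, and the scalar `‖g‖` is
uniformly an average of signs up to a small error.

Under the RNP, denting and Hahn-Banach give sets on which the averages of `T` nearly agree.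
Exhausting `Ω` by them approximates `T` by representable operators, which form a closed set. -/

namespace GeneratingOperators

open Filter Topology Set

/-! ### Averages of an operator on `L₁(μ)` -/

section OperatorMeasure

variable {Ω : Type*} [MeasurableSpace Ω] {μ : Measure Ω} [IsFiniteMeasure μ]
  {𝕜 Y : Type*} [RCLike 𝕜] [NormedAddCommGroup Y] [NormedSpace 𝕜 Y]

variable (μ 𝕜) in
open Classical in
/-- The indicator function of `A` as an element of `L₁(μ)`, with value `0` if `A` is not
measurable. -/
noncomputable def indL1 (A : Set Ω) : Lp 𝕜 1 μ :=
  if hA : MeasurableSet A then indicatorConstLp 1 hA (measure_ne_top μ A) 1 else 0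

lemma indL1_of_measurableSet {A : Set Ω} (hA : MeasurableSet A) :
    indL1 μ 𝕜 A = indicatorConstLp 1 hA (measure_ne_top μ A) 1 := by
  simp [indL1, hA]

lemma norm_indL1 {A : Set Ω} (hA : MeasurableSet A) : ‖indL1 μ 𝕜 A‖ = μ.real A := by
  rw [indL1_of_measurableSet hA, norm_indicatorConstLp one_ne_zero ENNReal.one_ne_top]
  simp

lemma norm_indL1_le (A : Set Ω) : ‖indL1 μ 𝕜 A‖ ≤ μ.real A := by
  by_cases hA : MeasurableSet A
  · exact (norm_indL1 hA).le
  · simp [indL1, hA]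

lemma indL1_coeFn {A : Set Ω} (hA : MeasurableSet A) :
    indL1 μ 𝕜 A =ᵐ[μ] A.indicator fun _ => 1 := by
  rw [indL1_of_measurableSet hA]
  exact indicatorConstLp_coeFn

/-- The vector measure `A ↦ T 1_A` of an operator on `L₁(μ)`. -/
noncomputable def operatorMeasure (T : Lp 𝕜 1 μ →L[𝕜] Y) : VectorMeasure Ω Y :=
  VectorMeasure.of_additive_of_le_measure (μ := ‖T‖₊ • μ) (fun A => T (indL1 μ 𝕜 A))
    (fun s => by
      have h : ‖T (indL1 μ 𝕜 s)‖ₑ ≤ ENNReal.ofReal (‖T‖ * μ.real s) := by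
        rw [← ofReal_norm]
        exact ENNReal.ofReal_le_ofReal ((T.le_opNorm _).trans (by
          gcongr; exact norm_indL1_le s))
      refine h.trans (le_of_eq ?_)
      rw [ENNReal.ofReal_mul (norm_nonneg _), ofReal_measureReal, ofReal_norm]
      rfl)
    (fun s t hs ht hst => by
      rw [indL1_of_measurableSet hs, indL1_of_measurableSet ht,
        indL1_of_measurableSet (hs.union ht), ← map_add,
        ← indicatorConstLp_disjoint_union hs ht _ _ hst])
    (fun s hs => by simp [indL1, hs])

lemma operatorMeasure_apply (T : Lp 𝕜 1 μ →L[𝕜] Y) (A : Set Ω) :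
    operatorMeasure T A = T (indL1 μ 𝕜 A) := rfl

lemma norm_operatorMeasure_le (T : Lp 𝕜 1 μ →L[𝕜] Y) (A : Set Ω) :
    ‖operatorMeasure T A‖ ≤ ‖T‖ * μ.real A :=
  (T.le_opNorm _).trans (by gcongr; exact norm_indL1_le A)

variable [NormedSpace ℝ Y]

/-- If every non-null part of `A` contains a non-null set on which the `φ`-average of `T` is at
most `α`, then the `φ`-average of `T` on `A` is at most `α`. -/
lemma apply_operatorMeasure_le_of_exists_subset (T : Lp 𝕜 1 μ →L[𝕜] Y) (φ : StrongDual ℝ Y)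
    {α : ℝ} {A : Set Ω} (hA : MeasurableSet A)
    (h : ∀ B ⊆ A, MeasurableSet B → μ B ≠ 0 →
      ∃ C ⊆ B, MeasurableSet C ∧ μ C ≠ 0 ∧ φ (operatorMeasure T C) ≤ α * μ.real C) :
    φ (operatorMeasure T A) ≤ α * μ.real A := by
  by_contra! hlt
  -- The gap `α < β` makes the final inequality on a non-null set contradictory.
  obtain ⟨β, hαβ, hβ⟩ : ∃ β, α < β ∧ β * μ.real A < φ (operatorMeasure T A) := by
    have hc : ContinuousAt (fun β => β * μ.real A) α := by fun_prop
    have h1 := hc.eventually_lt_const hlt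
    have h2 : ∀ᶠ β in 𝓝[>] α, β * μ.real A < φ (operatorMeasure T A) := nhdsWithin_le_nhds h1
    obtain ⟨β, h2, h3⟩ := (h2.and self_mem_nhdsWithin).exists
    exact ⟨β, h3, h2⟩
  let ν : SignedMeasure Ω := β • μ.toSignedMeasure -
    (operatorMeasure T).mapRange (φ : Y →+ ℝ) φ.continuous
  have hν : ∀ B, MeasurableSet B → ν B = β * μ.real B - φ (operatorMeasure T B) := by
    intro B hB
    rw [sub_apply, smul_apply, Measure.toSignedMeasure_apply_measurable hB]
    rfl
  -- Since `ν A < 0`, Hahn decomposition gives `B ⊆ A` with `ν B < 0` and `ν ≤ 0` on all measurable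
  -- parts of `B`. There all `φ`-averages are at least `β`.
  obtain ⟨B, hB, hBA, hneg, hBlt⟩ := SignedMeasure.exists_subset_restrict_nonpos (s := ν) (i := A)
    (by rw [hν A hA]; linarith)
  have hμB : μ B ≠ 0 := by
    intro h0
    have h1 : μ.real B = 0 := by simp [Measure.real, h0]
    have h2 : operatorMeasure T B = 0 := by
      have := norm_operatorMeasure_le T B
      rw [h1, mul_zero] at this
      exact norm_le_zero_iff.1 this
    rw [hν B hB, h1, h2] at hBlt
    simp at hBlt
  obtain ⟨C, hCB, hC, hμC, hle⟩ := h B hBA hB hμB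
  have h3 : ν C ≤ 0 := VectorMeasure.subset_le_of_restrict_le_restrict _ _ hB hneg hCB
  rw [hν C hC] at h3
  have h4 : 0 < μ.real C := ENNReal.toReal_pos hμC (measure_ne_top _ _)
  nlinarith

/-- A functional norming `T 1_A` reduces this to the scalar estimate. -/
lemma norm_operatorMeasure_le_of_exists_subset (T : Lp 𝕜 1 μ →L[𝕜] Y) {K : ℝ}
    (h : ∀ B, MeasurableSet B → μ B ≠ 0 →
      ∃ C ⊆ B, MeasurableSet C ∧ μ C ≠ 0 ∧ ‖operatorMeasure T C‖ ≤ K * μ.real C)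
    {A : Set Ω} (hA : MeasurableSet A) : ‖operatorMeasure T A‖ ≤ K * μ.real A := by
  obtain ⟨φ, hφ, hφA⟩ := exists_dual_vector'' ℝ (operatorMeasure T A)
  have hφA' : φ (operatorMeasure T A) = ‖operatorMeasure T A‖ := by simpa using hφA
  rw [← hφA']
  refine apply_operatorMeasure_le_of_exists_subset T φ hA fun B _ hB hμB => ?_
  obtain ⟨C, hCB, hC, hμC, hle⟩ := h B hB hμB
  refine ⟨C, hCB, hC, hμC, (le_abs_self _).trans (((φ.le_opNorm _).trans ?_).trans hle)⟩
  exact mul_le_of_le_one_left (norm_nonneg _) hφ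

/-- An operator on `L₁(μ)` is bounded by `K` as soon as every non-null set contains a non-null set
on which its average is bounded by `K`. -/
lemma norm_apply_le_of_exists_subset (T : Lp 𝕜 1 μ →L[𝕜] Y) {K : ℝ}
    (h : ∀ B, MeasurableSet B → μ B ≠ 0 →
      ∃ C ⊆ B, MeasurableSet C ∧ μ C ≠ 0 ∧ ‖operatorMeasure T C‖ ≤ K * μ.real C)
    (f : Lp 𝕜 1 μ) : ‖T f‖ ≤ K * ‖f‖ := by
  induction f using Lp.induction ENNReal.one_ne_top with
  | indicatorConst c hs hμs =>
    rename_i s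
    rw [Lp.simpleFunc.coe_indicatorConst]
    have h1 : indicatorConstLp 1 hs hμs.ne c = c • indL1 μ 𝕜 s := by
      rw [indL1_of_measurableSet hs, indicatorConstLp, indicatorConstLp, ← MemLp.toLp_const_smul]
      congr 1
      ext x
      by_cases hx : x ∈ s <;> simp [hx]
    rw [h1, map_smul, norm_smul, norm_smul, norm_indL1 hs]
    have := norm_operatorMeasure_le_of_exists_subset T h hs
    rw [operatorMeasure_apply] at this
    calc _ ≤ ‖c‖ * (K * μ.real s) := by gcongr
      _ = _ := by ring
  | add hf hg hfg ihf ihg =>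
    rename_i f g
    -- The `L₁` norm is additive on disjoint supports, so the bound passes to sums.
    have hn : ‖hf.toLp f + hg.toLp g‖ = ‖hf.toLp f‖ + ‖hg.toLp g‖ := by
      have key : ∀ u : Ω → 𝕜, ∀ hu : MemLp u 1 μ, ‖hu.toLp u‖ = ∫ x, ‖u x‖ ∂μ := by
        intro u hu
        exact L1.norm_of_fun_eq_integral_norm (memLp_one_iff_integrable.1 hu)
      rw [← MemLp.toLp_add, key, key, key, ← integral_add
        (memLp_one_iff_integrable.1 hf).norm (memLp_one_iff_integrable.1 hg).norm]
      congr 1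
      ext x
      rcases eq_or_ne (f x) 0 with h0 | h0
      · simp [h0]
      · have : g x = 0 := by
          by_contra h1
          exact Set.disjoint_left.1 hfg h0 h1
        simp [this]
    rw [map_add, hn, mul_add]
    exact (norm_add_le _ _).trans (add_le_add ihf ihg)
  | isClosed => exact isClosed_le (by fun_prop) (by fun_prop)

end OperatorMeasure

/-! ### Essentially bounded functions -/

section EssentiallyBounded

variable {Ω : Type*} [MeasurableSpace Ω] {μ : Measure Ω} {Y : Type*} [NormedAddCommGroup Y]

lemma norm_le_iff_ae_norm_le {g : Lp Y ∞ μ} {c : ℝ} (hc : 0 ≤ c) :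
    ‖g‖ ≤ c ↔ ∀ᵐ t ∂μ, ‖g t‖ ≤ c := by
  rw [Lp.norm_def, eLpNorm_exponent_top]
  have hfin : eLpNormEssSup g μ ≠ ∞ := by
    rw [← eLpNorm_exponent_top]; exact Lp.eLpNorm_ne_top g
  constructor
  · intro h
    filter_upwards [enorm_ae_le_eLpNormEssSup g μ] with t ht
    rw [← toReal_enorm]
    exact (ENNReal.toReal_mono hfin ht).trans h
  · intro h
    exact ENNReal.toReal_le_of_le_ofReal hc (eLpNormEssSup_le_of_ae_bound h)

/-- A strongly measurable function is nearly constant on a non-null part of any non-null set. -/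
lemma exists_subset_norm_sub_lt {g : Ω → Y} (hg : StronglyMeasurable g) {δ : ℝ} (hδ : 0 < δ)
    {A : Set Ω} (hA : MeasurableSet A) (hμA : μ A ≠ 0) :
    ∃ B ⊆ A, MeasurableSet B ∧ μ B ≠ 0 ∧ ∃ y, ∀ t ∈ B, ‖g t - y‖ < δ := by
  -- The `δ`-balls around a countable set dense in the range cover it, so one of the preimages meets
  -- `A` in a non-null set.
  obtain ⟨c, hc, hgc⟩ := hg.isSeparable_range
  by_contra! hcon
  have hnull : ∀ y ∈ c, μ (A ∩ {t | ‖g t - y‖ < δ}) = 0 := by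
    intro y _
    by_contra h0
    obtain ⟨t, ht, hle⟩ := hcon _ inter_subset_left
      (hA.inter (measurableSet_lt (hg.sub stronglyMeasurable_const).norm.measurable
        measurable_const)) h0 y
    exact absurd ht.2 (not_lt.2 hle)
  refine hμA (measure_mono_null ?_ ((measure_biUnion_null_iff hc).2 hnull))
  intro t ht
  obtain ⟨y, hy, hty⟩ := Metric.mem_closure_iff.1 (hgc (mem_range_self t)) δ hδ
  exact mem_biUnion hy ⟨ht, by rw [mem_ofPred_eq, ← dist_eq_norm]; exact hty⟩

lemma Lp_coeFn_finset_sum {ι : Type*} (s : Finset ι) (h : ι → Lp Y ∞ μ) :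
    ∀ᵐ t ∂μ, (∑ i ∈ s, h i : Lp Y ∞ μ) t = ∑ i ∈ s, h i t := by
  classical
  induction s using Finset.induction_on with
  | empty =>
    filter_upwards [Lp.coeFn_zero Y ∞ μ] with t ht
    simpa using ht
  | insert i s hi ih =>
    rw [Finset.sum_insert hi]
    filter_upwards [ih, Lp.coeFn_add (h i) (∑ i ∈ s, h i)] with t h1 h2
    rw [h2, Pi.add_apply, h1, Finset.sum_insert hi]

end EssentiallyBounded

/-! ### Integral operators and generation -/

section IntegralOperator

variable {Ω : Type*} [MeasurableSpace Ω] {μ : Measure Ω}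
  {𝕜 Y : Type*} [RCLike 𝕜] [NormedAddCommGroup Y] [NormedSpace ℝ Y] [NormedSpace 𝕜 Y]
  [IsScalarTower ℝ 𝕜 Y] [CompleteSpace Y]

variable (μ 𝕜 Y) in
/-- The operator `f ↦ ∫ f g dμ` on `L₁(μ)`, depending linearly on its density `g ∈ L_∞(μ, Y)`. -/
noncomputable def integralOperator : Lp Y ∞ μ →L[𝕜] Lp 𝕜 1 μ →L[𝕜] Y :=
  ((ContinuousLinearMap.lsmul 𝕜 𝕜 : 𝕜 →L[𝕜] Y →L[𝕜] Y).lpPairing μ 1 ∞).flip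

lemma integralOperator_apply (g : Lp Y ∞ μ) (f : Lp 𝕜 1 μ) :
    integralOperator μ 𝕜 Y g f = ∫ t, f t • g t ∂μ :=
  ContinuousLinearMap.lpPairing_eq_integral _ f g

lemma isRepresentable_iff {T : Lp 𝕜 1 μ →L[𝕜] Y} :
    IsRepresentable T ↔ ∃ g, integralOperator μ 𝕜 Y g = T := by
  refine exists_congr fun g => ?_
  rw [ContinuousLinearMap.ext_iff]
  exact forall_congr' fun f => by rw [integralOperator_apply, eq_comm]

lemma norm_integralOperator_le (g : Lp Y ∞ μ) : ‖integralOperator μ 𝕜 Y g‖ ≤ ‖g‖ := by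
  refine ContinuousLinearMap.opNorm_le_bound _ (norm_nonneg _) fun f => ?_
  rw [integralOperator_apply, mul_comm, L1.norm_eq_integral_norm, ← integral_mul_const]
  refine norm_integral_le_of_norm_le ((L1.integrable_coeFn f).norm.mul_const _) ?_
  filter_upwards [(norm_le_iff_ae_norm_le (norm_nonneg g)).1 le_rfl] with t ht
  rw [norm_smul]
  gcongr

variable [IsFiniteMeasure μ]

lemma operatorMeasure_integralOperator (g : Lp Y ∞ μ) {A : Set Ω} (hA : MeasurableSet A) :
    operatorMeasure (integralOperator μ 𝕜 Y g) A = ∫ t in A, g t ∂μ := by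
  rw [operatorMeasure_apply, integralOperator_apply, ← integral_indicator hA]
  refine integral_congr_ae ?_
  filter_upwards [indL1_coeFn (μ := μ) (𝕜 := 𝕜) hA] with t ht
  by_cases h : t ∈ A <;> simp [ht, h]

lemma norm_operatorMeasure_integralOperator_sub_le (g : Lp Y ∞ μ) {A : Set Ω}
    (hA : MeasurableSet A) {y : Y} {δ : ℝ} (h : ∀ᵐ t ∂μ, t ∈ A → ‖g t - y‖ ≤ δ) :
    ‖operatorMeasure (integralOperator μ 𝕜 Y g) A - μ.real A • y‖ ≤ δ * μ.real A := by
  have hg : Integrable g μ := (Lp.memLp g).integrable le_top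
  rw [operatorMeasure_integralOperator g hA, ← setIntegral_const,
    ← integral_sub hg.integrableOn (integrable_const y)]
  exact norm_setIntegral_le_of_norm_le_const_ae' (measure_lt_top _ _) h

lemma sub_mul_le_norm_operatorMeasure_integralOperator (g : Lp Y ∞ μ) {A : Set Ω}
    (hA : MeasurableSet A) (hμA : μ A ≠ 0) {y : Y} {c δ : ℝ} (hc : ∀ t ∈ A, c ≤ ‖g t‖)
    (h : ∀ t ∈ A, ‖g t - y‖ < δ) :
    (c - 2 * δ) * μ.real A ≤ ‖operatorMeasure (integralOperator μ 𝕜 Y g) A‖ := by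
  have h1 := norm_operatorMeasure_integralOperator_sub_le (𝕜 := 𝕜) g hA
    (ae_of_all μ fun t ht => (h t ht).le)
  obtain ⟨t, ht⟩ := nonempty_of_measure_ne_zero hμA
  have h2 : c - δ ≤ ‖y‖ := by
    have := norm_sub_norm_le (g t) y
    linarith [hc t ht, h t ht]
  have h3 := norm_sub_norm_le (μ.real A • y) (operatorMeasure (integralOperator μ 𝕜 Y g) A)
  rw [norm_sub_rev, norm_smul, Real.norm_of_nonneg measureReal_nonneg] at h3
  nlinarith [measureReal_nonneg (μ := μ) (s := A)]

/-- Where `‖g‖` exceeds the operator norm by `ε`, a non-null set of near constancy would have too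
large an average. -/
lemma norm_le_norm_integralOperator (g : Lp Y ∞ μ) : ‖g‖ ≤ ‖integralOperator μ 𝕜 Y g‖ := by
  refine le_of_forall_pos_le_add fun ε hε => ?_
  rw [norm_le_iff_ae_norm_le (by positivity), ae_iff]
  by_contra h0
  simp only [not_le] at h0
  obtain ⟨B, hBA, hB, hμB, y, hy⟩ := exists_subset_norm_sub_lt (Lp.stronglyMeasurable g)
    (by positivity : 0 < ε / 4)
    (measurableSet_lt measurable_const (Lp.stronglyMeasurable g).norm.measurable) h0
  have h1 := sub_mul_le_norm_operatorMeasure_integralOperator (𝕜 := 𝕜) g hB hμB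
    (fun t ht => le_of_lt (hBA ht)) hy
  have h2 := norm_operatorMeasure_le (integralOperator μ 𝕜 Y g) B
  have h3 : 0 < μ.real B := ENNReal.toReal_pos hμB (measure_ne_top _ _)
  nlinarith

lemma norm_integralOperator (g : Lp Y ∞ μ) : ‖integralOperator μ 𝕜 Y g‖ = ‖g‖ :=
  le_antisymm (norm_integralOperator_le g) (norm_le_norm_integralOperator g)

/-- If `‖g‖ = 1` a.e., then every operator on `L₁(μ)` is normed by the attainment sets of
`f ↦ ∫ f g dμ`. -/
lemma norm_apply_le_of_forall_mem_att {g : Lp Y ∞ μ} (hg : ∀ᵐ t ∂μ, ‖g t‖ = 1)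
    (T : Lp 𝕜 1 μ →L[𝕜] Y) {δ K : ℝ} (hδ : 0 < δ)
    (h : ∀ f ∈ att (integralOperator μ 𝕜 Y g) δ, ‖T f‖ ≤ K) (f : Lp 𝕜 1 μ) :
    ‖T f‖ ≤ K * ‖f‖ := by
  refine norm_apply_le_of_exists_subset T (fun B hB hμB => ?_) f
  have hS : MeasurableSet {t | ‖g t‖ = 1} :=
    measurableSet_eq_fun (Lp.stronglyMeasurable g).norm.measurable measurable_const
  have hμ : μ (B ∩ {t | ‖g t‖ = 1}) ≠ 0 := by
    rwa [measure_inter_conull (t := {t | ‖g t‖ = 1}) (ae_iff.1 hg)]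
  -- With oscillation `δ / 4`, the average on `C` has norm at least `1 - δ / 2 > 1 - δ`.
  obtain ⟨C, hCB, hC, hμC, y, hy⟩ := exists_subset_norm_sub_lt (Lp.stronglyMeasurable g)
    (by positivity : 0 < δ / 4) (hB.inter hS) hμ
  refine ⟨C, hCB.trans inter_subset_left, hC, hμC, ?_⟩
  have hpos : 0 < μ.real C := ENNReal.toReal_pos hμC (measure_ne_top _ _)
  have h1 := sub_mul_le_norm_operatorMeasure_integralOperator (𝕜 := 𝕜) g hC hμC
    (fun t ht => (hCB ht).2.ge) hy
  have hsc : ∀ S : Lp 𝕜 1 μ →L[𝕜] Y,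
      ‖S (((μ.real C)⁻¹ : 𝕜) • indL1 μ 𝕜 C)‖ = (μ.real C)⁻¹ * ‖operatorMeasure S C‖ := by
    intro S
    rw [map_smul, norm_smul, norm_inv, RCLike.norm_ofReal, abs_of_pos hpos, operatorMeasure_apply]
  have h2 := h (((μ.real C)⁻¹ : 𝕜) • indL1 μ 𝕜 C) ⟨by
    rw [norm_smul, norm_inv, RCLike.norm_ofReal, abs_of_pos hpos, norm_indL1 hC,
      inv_mul_cancel₀ hpos.ne'], by
    rw [hsc, inv_mul_eq_div, lt_div_iff₀ hpos]
    nlinarith⟩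
  rwa [hsc, inv_mul_eq_div, div_le_iff₀ hpos] at h2

/-- The operator `f ↦ ∫ f g dμ` is generating if `‖g‖ = 1` a.e. -/
lemma isGenerating_integralOperator (hμ : μ ≠ 0) {g : Lp Y ∞ μ} (hg : ∀ᵐ t ∂μ, ‖g t‖ = 1) :
    IsGenerating (integralOperator μ 𝕜 Y g) := by
  constructor
  · refine le_antisymm ((norm_integralOperator_le g).trans
      ((norm_le_iff_ae_norm_le zero_le_one).2 (hg.mono fun t ht => ht.le))) ?_
    refine le_of_forall_pos_le_add fun ε hε => ?_
    obtain ⟨f, hf1, hf2⟩ : (att (integralOperator μ 𝕜 Y g) ε).Nonempty := by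
      by_contra hne
      rw [not_nonempty_iff_eq_empty] at hne
      -- Over an empty attainment set every bound holds, even `K = -1`, which is absurd on `1_Ω`.
      have h1 := norm_apply_le_of_forall_mem_att hg (integralOperator μ 𝕜 Y g) (K := -1) hε
        (by simp [hne]) (indL1 μ 𝕜 univ)
      rw [norm_indL1 MeasurableSet.univ] at h1
      have h2 : 0 < μ.real univ :=
        ENNReal.toReal_pos (by simpa using hμ) (measure_ne_top _ _)
      linarith [norm_nonneg (integralOperator μ 𝕜 Y g (indL1 μ 𝕜 univ))]
    have h3 := (integralOperator μ 𝕜 Y g).le_opNorm f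
    rw [hf1, mul_one] at h3
    linarith
  · intro T
    have key : ∀ δ : Ioi (0 : ℝ), relNormAt (integralOperator μ 𝕜 Y g) δ T = ‖T‖ := by
      rintro ⟨δ, hδ⟩
      have hle : ∀ r ∈ (fun f => ‖T f‖) '' att (integralOperator μ 𝕜 Y g) δ, r ≤ ‖T‖ := by
        rintro _ ⟨f, hf, rfl⟩
        simpa [hf.1] using T.le_opNorm f
      refine le_antisymm (Real.sSup_le hle (norm_nonneg _)) ?_
      refine T.opNorm_le_bound (Real.sSup_nonneg ?_) ?_
      · rintro _ ⟨f, -, rfl⟩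
        exact norm_nonneg _
      · exact norm_apply_le_of_forall_mem_att hg T hδ fun f hf =>
          le_csSup ⟨_, hle⟩ (mem_image_of_mem _ hf)
    simp [relNorm, key]

end IntegralOperator

/-! ### Averages of unimodular functions -/

section UnitBall

variable {Ω : Type*} [MeasurableSpace Ω] {μ : Measure Ω}
  {Y : Type*} [NormedAddCommGroup Y] [NormedSpace ℝ Y]

lemma sum_range_ite_lt_sub {m n : ℕ} (h : m ≤ n) :
    ∑ k ∈ Finset.range n, (if k < m then (1 : ℝ) else -1) = 2 * m - n := by
  obtain ⟨j, rfl⟩ := Nat.exists_eq_add_of_le h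
  rw [Finset.sum_range_add, Finset.sum_congr rfl (g := fun _ => (1 : ℝ))
    (fun k hk => if_pos (Finset.mem_range.1 hk))]
  simp
  ring

/-- A number in `[0, 1]` is approximated within `2 / n` by an average of `n` signs. -/
lemma abs_sub_average_signs_le {r : ℝ} (hr0 : 0 ≤ r) (hr1 : r ≤ 1) {n : ℕ} (hn : 0 < n) :
    |r - (n : ℝ)⁻¹ * ∑ k ∈ Finset.range n,
      (if k < ⌊(n : ℝ) * (1 + r) / 2⌋₊ then (1 : ℝ) else -1)| ≤ 2 / n := by
  have hn' : (0 : ℝ) < n := by exact_mod_cast hn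
  have h0 : 0 ≤ (n : ℝ) * (1 + r) / 2 := by positivity
  have hle : ⌊(n : ℝ) * (1 + r) / 2⌋₊ ≤ n := by
    refine Nat.floor_le_of_le ?_
    nlinarith
  rw [sum_range_ite_lt_sub hle]
  have h1 := Nat.floor_le h0
  have h2 := Nat.lt_floor_add_one ((n : ℝ) * (1 + r) / 2)
  set m : ℝ := ((⌊(n : ℝ) * (1 + r) / 2⌋₊ : ℕ) : ℝ)
  have h3 : r - (n : ℝ)⁻¹ * (2 * m - n) = (n * (1 + r) - 2 * m) / n := by
    field_simp
    ring
  rw [h3, abs_of_nonneg (div_nonneg (by linarith) hn'.le)]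
  gcongr
  linarith

variable (μ Y) in
/-- The unit ball of `L_∞(μ, Y)` is the closed convex hull of the unimodular functions. -/
theorem closedBall_Lp_top_eq_closure_convexHull [Nontrivial Y] :
    closedBall (0 : Lp Y ∞ μ) 1 = closure (convexHull ℝ {g : Lp Y ∞ μ | ∀ᵐ t ∂μ, ‖g t‖ = 1}) := by
  refine subset_antisymm (fun g hg => ?_) ?_
  · rw [mem_closedBall_zero_iff, norm_le_iff_ae_norm_le zero_le_one] at hg
    obtain ⟨e, he⟩ := exists_norm_eq Y zero_le_one
    have hgm : StronglyMeasurable g := Lp.stronglyMeasurable g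
    have hrm : Measurable fun t => ‖g t‖ := hgm.norm.measurable
    let u : Ω → Y := fun t => if ‖g t‖ = 0 then e else ‖g t‖⁻¹ • g t
    have hu : StronglyMeasurable u :=
      StronglyMeasurable.ite (measurableSet_eq_fun hrm measurable_const)
        stronglyMeasurable_const (hrm.inv.stronglyMeasurable.smul hgm)
    have hu1 : ∀ t, ‖u t‖ = 1 := by
      intro t
      by_cases h : ‖g t‖ = 0
      · simp only [u, if_pos h, he]
      · simp only [u, if_neg h]
        rw [norm_smul, norm_inv, norm_norm, inv_mul_cancel₀ h]
    have hgu : ∀ t, ‖g t‖ • u t = g t := by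
      intro t
      by_cases h : ‖g t‖ = 0
      · rw [h, zero_smul, norm_eq_zero.1 h]
      · simp only [u, if_neg h]
        rw [smul_inv_smul₀ h]
    rw [Metric.mem_closure_iff]
    intro ε hε
    obtain ⟨n, hn⟩ := exists_nat_gt (2 / ε)
    have hn' : (0 : ℝ) < n := (by positivity : 0 < 2 / ε).trans hn
    -- With `m` plus signs among `n` the average is `2 * m / n - 1`, so `m` is the floor of `n * (1
    -- + ‖g t‖) / 2`.
    let s : ℕ → Ω → ℝ := fun k t => if k < ⌊(n : ℝ) * (1 + ‖g t‖) / 2⌋₊ then 1 else -1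
    have hs : ∀ k, Measurable (s k) := by
      intro k
      refine Measurable.ite (measurableSet_lt measurable_const ?_) measurable_const measurable_const
      exact Nat.measurable_floor.comp (by fun_prop)
    have hs1 : ∀ k t, ‖s k t • u t‖ = 1 := by
      intro k t
      rw [norm_smul, hu1, mul_one]
      simp only [s]
      split_ifs <;> simp
    have hmem : ∀ k, MemLp (fun t => s k t • u t) ∞ μ := fun k =>
      memLp_top_of_bound ((hs k).stronglyMeasurable.smul hu).aestronglyMeasurable 1
        (ae_of_all _ fun t => (hs1 k t).le)
    refine ⟨∑ k ∈ Finset.range n, (n : ℝ)⁻¹ • (hmem k).toLp, ?_, ?_⟩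
    · refine (convex_convexHull ℝ _).sum_mem (fun _ _ => by positivity) ?_ fun k _ =>
        subset_convexHull ℝ _ ?_
      · simp [hn'.ne']
      · filter_upwards [(hmem k).coeFn_toLp] with t ht
        rw [ht, hs1]
    · refine lt_of_le_of_lt ?_ ((div_lt_comm₀ hε hn').1 hn)
      rw [dist_eq_norm, norm_le_iff_ae_norm_le (by positivity)]
      filter_upwards [hg, Lp.coeFn_sub g (∑ k ∈ Finset.range n, (n : ℝ)⁻¹ • (hmem k).toLp),
        Lp_coeFn_finset_sum (Finset.range n) fun k => (n : ℝ)⁻¹ • (hmem k).toLp,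
        ae_all_iff.2 fun k => Lp.coeFn_smul (n : ℝ)⁻¹ (hmem k).toLp,
        ae_all_iff.2 fun k => (hmem k).coeFn_toLp] with t h1 h2 h3 h4 h5
      rw [h2, Pi.sub_apply, h3]
      simp only [h4, Pi.smul_apply, h5]
      rw [← Finset.smul_sum, ← Finset.sum_smul, smul_smul]
      nth_rewrite 1 [← hgu t]
      rw [← sub_smul, norm_smul, hu1, mul_one]
      exact abs_sub_average_signs_le (norm_nonneg _) h1 (by exact_mod_cast hn')
  · refine closure_minimal (convexHull_min (fun g hg => ?_) (convex_closedBall _ _))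
      isClosed_closedBall
    rw [mem_closedBall_zero_iff, norm_le_iff_ae_norm_le zero_le_one]
    exact Eventually.mono hg fun t ht => le_of_eq ht

end UnitBall

section Generating

variable {Ω : Type*} [MeasurableSpace Ω] {μ : Measure Ω}
  {𝕜 Y : Type*} [RCLike 𝕜] [NormedAddCommGroup Y] [NormedSpace ℝ Y] [NormedSpace 𝕜 Y]
  [IsScalarTower ℝ 𝕜 Y]

variable (μ 𝕜 Y) in
lemma closure_convexHull_Gen_subset_closedBall :
    closure (convexHull ℝ (Gen 𝕜 (Lp 𝕜 1 μ) Y)) ⊆ closedBall (0 : Lp 𝕜 1 μ →L[𝕜] Y) 1 := by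
  refine closure_minimal (convexHull_min (fun G hG => ?_) ?_) isClosed_closedBall
  · rw [mem_closedBall_zero_iff]
    exact hG.1.le
  · intro S hS T hT a b ha hb hab
    rw [mem_closedBall_zero_iff] at hS hT ⊢
    refine ContinuousLinearMap.opNorm_le_bound _ zero_le_one fun f => ?_
    have h1 : ‖S f‖ ≤ ‖f‖ := (S.le_opNorm f).trans (mul_le_of_le_one_left (norm_nonneg _) hS)
    have h2 : ‖T f‖ ≤ ‖f‖ := (T.le_opNorm f).trans (mul_le_of_le_one_left (norm_nonneg _) hT)
    calc ‖(a • S + b • T) f‖ ≤ ‖a • S f‖ + ‖b • T f‖ := norm_add_le _ _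
      _ ≤ a * ‖f‖ + b * ‖f‖ := by
        rw [norm_smul, norm_smul, Real.norm_of_nonneg ha, Real.norm_of_nonneg hb]
        gcongr
      _ = 1 * ‖f‖ := by rw [← add_mul, hab]

end Generating

/-! ### Representable operators -/

section Representable

variable {Ω : Type*} [MeasurableSpace Ω] {μ : Measure Ω} [IsFiniteMeasure μ]
  {𝕜 Y : Type*} [RCLike 𝕜] [NormedAddCommGroup Y] [NormedSpace ℝ Y] [NormedSpace 𝕜 Y]
  [IsScalarTower ℝ 𝕜 Y] [CompleteSpace Y]

theorem representableBall_subset_closure_convexHull_Gen [Nontrivial Y] (hμ : μ ≠ 0) :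
    representableBall μ 𝕜 Y ⊆ closure (convexHull ℝ (Gen 𝕜 (Lp 𝕜 1 μ) Y)) := by
  rintro T ⟨hT, hrep⟩
  obtain ⟨g, rfl⟩ := isRepresentable_iff.1 hrep
  rw [norm_integralOperator, ← mem_closedBall_zero_iff,
    closedBall_Lp_top_eq_closure_convexHull] at hT
  -- Continuous additive maps are real-linear, hence compatible with real convex hulls.
  let Φ : Lp Y ∞ μ →L[ℝ] Lp 𝕜 1 μ →L[𝕜] Y :=
    (integralOperator μ 𝕜 Y : Lp Y ∞ μ →+ Lp 𝕜 1 μ →L[𝕜] Y).toRealLinearMap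
      (integralOperator μ 𝕜 Y).continuous
  have h1 := image_closure_subset_closure_image Φ.continuous (mem_image_of_mem Φ hT)
  refine closure_mono ?_ h1
  rw [← ContinuousLinearMap.coe_coe, LinearMap.image_convexHull]
  refine convexHull_mono ?_
  rintro _ ⟨g, hg, rfl⟩
  exact isGenerating_integralOperator hμ hg

end Representable

/-! ### Dentability of bounded sets -/

section Dentability

variable {Y : Type*} [NormedAddCommGroup Y] [NormedSpace ℝ Y]

/-- In a space with the Radon-Nikodým property every bounded set is dentable. -/
lemma HasRNP.exists_notMem_closure_convexHull (hY : HasRNP Y) {D : Set Y} (hD : D.Nonempty)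
    (hbdd : Bornology.IsBounded D) {ε : ℝ} (hε : 0 < ε) :
    ∃ d ∈ D, d ∉ closure (convexHull ℝ (D \ ball d ε)) := by
  obtain ⟨x, hx, hdent⟩ := hY (closure (convexHull ℝ D)) (hD.convexHull.closure)
    isClosed_closure (convex_convexHull ℝ D).closure (isBounded_convexHull.2 hbdd).closure
  set K := closure (convexHull ℝ (closure (convexHull ℝ D) \ ball x (ε / 2))) with hK
  have hxK : x ∉ K := hdent (ε / 2) (by positivity)
  have hDC : D ⊆ closure (convexHull ℝ D) := (subset_convexHull ℝ D).trans subset_closure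
  have hsub : closure (convexHull ℝ D) \ ball x (ε / 2) ⊆ K :=
    (subset_convexHull ℝ _).trans subset_closure
  -- If `D ⊆ K`, then `x ∈ K`. A point of `D` outside `K` is within `ε / 2` of `x`, so its `ε`-ball
  -- contains `ball x (ε / 2)`.
  obtain ⟨d, hd, hdK⟩ : ∃ d ∈ D, d ∉ K := by
    by_contra! hcon
    exact hxK (closure_minimal (convexHull_min hcon (convex_convexHull ℝ _).closure)
      isClosed_closure hx)
  have hdx : dist d x < ε / 2 := by
    by_contra h
    exact hdK (hsub ⟨hDC hd, h⟩)
  refine ⟨d, hd, fun hmem => hdK (closure_mono (convexHull_mono ?_) hmem)⟩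
  rintro z ⟨hz, hzd⟩
  refine ⟨hDC hz, fun hzx => hzd ?_⟩
  rw [mem_ball] at hzx ⊢
  linarith [dist_triangle_right z d x]

end Dentability

/-! ### Exhaustion by disjoint sets -/

section Exhaustion

variable {Ω : Type*} [MeasurableSpace Ω] {μ : Measure Ω} [IsFiniteMeasure μ]

/-- If every non-null set contains a non-null set with property `P`, then almost all of the space
is a countable disjoint union of non-null sets with property `P`. -/
lemma exists_countable_pairwiseDisjoint {P : Set Ω → Prop}
    (h : ∀ A, MeasurableSet A → μ A ≠ 0 → ∃ B ⊆ A, MeasurableSet B ∧ μ B ≠ 0 ∧ P B) :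
    ∃ S : Set (Set Ω), S.Countable ∧ (∀ B ∈ S, MeasurableSet B ∧ μ B ≠ 0 ∧ P B) ∧
      S.PairwiseDisjoint id ∧ μ (⋃ B ∈ S, B)ᶜ = 0 := by
  obtain ⟨S, hS⟩ := zorn_subset
    {S : Set (Set Ω) | (∀ B ∈ S, MeasurableSet B ∧ μ B ≠ 0 ∧ P B) ∧ S.PairwiseDisjoint id} (by
      intro c hc hchain
      refine ⟨⋃₀ c, ⟨?_, ?_⟩, fun s hs => subset_sUnion_of_mem hs⟩
      · rintro B ⟨s, hs, hB⟩
        exact (hc hs).1 B hB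
      · exact (pairwiseDisjoint_sUnion hchain.directedOn).2 fun s hs => (hc hs).2)
  obtain ⟨hSP, hSd⟩ := hS.prop
  -- A finite measure admits only countably many disjoint non-null sets.
  have hcount : S.Countable := by
    have h1 := Measure.countable_meas_pos_of_disjoint_iUnion (μ := μ)
      (As := fun B : S => (B : Set Ω)) (fun B => (hSP B B.2).1)
      (fun B C hBC => hSd B.2 C.2 (Subtype.coe_injective.ne hBC))
    have h2 : {B : S | 0 < μ (B : Set Ω)} = univ :=
      eq_univ_of_forall fun B => pos_iff_ne_zero.2 (hSP B B.2).2.1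
    rw [h2, countable_univ_iff] at h1
    exact h1.to_set
  refine ⟨S, hcount, hSP, hSd, ?_⟩
  by_contra h0
  have hU : MeasurableSet (⋃ B ∈ S, B) := MeasurableSet.biUnion hcount fun B hB => (hSP B hB).1
  obtain ⟨B, hBU, hB, hμB, hPB⟩ := h _ hU.compl h0
  have hdisj : ∀ C ∈ S, Disjoint B C := fun C hC =>
    disjoint_left.2 fun t htB htC => hBU htB (mem_biUnion hC htC)
  have hins : insert B S ⊆ S := hS.le_of_ge (y := insert B S) ⟨by
    rintro C (rfl | hC)
    exacts [⟨hB, hμB, hPB⟩, hSP C hC], hSd.insert fun C hC _ => hdisj C hC⟩ (subset_insert B S)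
  have hBS : B ∈ S := hins (mem_insert B S)
  have hBe : B = ∅ := disjoint_self.1 (hdisj B hBS)
  exact hμB (by rw [hBe, measure_empty])

end Exhaustion

/-! ### Representability under the RNP -/

section RadonNikodym

variable {Ω : Type*} [MeasurableSpace Ω] {μ : Measure Ω} [IsFiniteMeasure μ]
  {𝕜 Y : Type*} [RCLike 𝕜] [NormedAddCommGroup Y] [NormedSpace ℝ Y] [NormedSpace 𝕜 Y]

/-- In a space with the Radon-Nikodým property, every non-null set contains a non-null set on
which the averages of a given operator are nearly constant. -/
lemma HasRNP.exists_subset_operatorMeasure_sub_le (hY : HasRNP Y) (T : Lp 𝕜 1 μ →L[𝕜] Y)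
    {ε : ℝ} (hε : 0 < ε) {A : Set Ω} (hA : MeasurableSet A) (hμA : μ A ≠ 0) :
    ∃ B ⊆ A, MeasurableSet B ∧ μ B ≠ 0 ∧ ∃ y : Y, ∀ C ⊆ B, MeasurableSet C →
      ‖operatorMeasure T C - μ.real C • y‖ ≤ ε * μ.real C := by
  by_contra! hcon
  have hpos : ∀ B : Set Ω, μ B ≠ 0 → 0 < μ.real B := fun B hB =>
    ENNReal.toReal_pos hB (measure_ne_top _ _)
  let avg : Set Ω → Y := fun B => (μ.real B)⁻¹ • operatorMeasure T B
  have hsmul : ∀ B, μ B ≠ 0 → μ.real B • avg B = operatorMeasure T B := fun B hB =>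
    smul_inv_smul₀ (hpos B hB).ne' _
  let D : Set Y := avg '' {B | B ⊆ A ∧ MeasurableSet B ∧ μ B ≠ 0}
  have hD : Bornology.IsBounded D := by
    refine isBounded_iff_forall_norm_le.2 ⟨‖T‖, ?_⟩
    rintro _ ⟨B, ⟨-, -, hμB⟩, rfl⟩
    rw [norm_smul, norm_inv, Real.norm_of_nonneg measureReal_nonneg, inv_mul_le_iff₀ (hpos B hμB),
      mul_comm]
    exact norm_operatorMeasure_le T B
  obtain ⟨_, ⟨B, ⟨hBA, hB, hμB⟩, rfl⟩, hnot⟩ :=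
    hY.exists_notMem_closure_convexHull (D := D) ⟨_, A, ⟨subset_rfl, hA, hμA⟩, rfl⟩ hD hε
  -- Averages at distance at least `ε` from `avg B` have `φ < α < φ (avg B)`. By `hcon`, every
  -- non-null part of `B` contains a set with such an average, forcing `φ (avg B) ≤ α`.
  obtain ⟨φ, α, hφ, hα⟩ := geometric_hahn_banach_closed_point
    (convex_convexHull ℝ (D \ ball (avg B) ε)).closure isClosed_closure hnot
  have hle : φ (operatorMeasure T B) ≤ α * μ.real B := by
    refine apply_operatorMeasure_le_of_exists_subset T φ hB fun E hEB hE hμE => ?_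
    obtain ⟨C, hCE, hC, hlt⟩ := hcon E (hEB.trans hBA) hE hμE (avg B)
    have hμC : μ C ≠ 0 := by
      intro h0
      have h1 : μ.real C = 0 := by simp [Measure.real, h0]
      have h2 := norm_operatorMeasure_le T C
      rw [h1, mul_zero] at h2
      rw [h1, zero_smul, mul_zero, sub_zero] at hlt
      linarith
    refine ⟨C, hCE, hC, hμC, ?_⟩
    have hmem : avg C ∈ D \ ball (avg B) ε := by
      refine ⟨⟨C, ⟨hCE.trans (hEB.trans hBA), hC, hμC⟩, rfl⟩, fun hball => ?_⟩
      rw [mem_ball, dist_eq_norm] at hball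
      rw [← hsmul C hμC, ← smul_sub, norm_smul, Real.norm_of_nonneg measureReal_nonneg] at hlt
      nlinarith [hpos C hμC]
    have h3 := hφ _ (subset_closure (subset_convexHull ℝ _ hmem))
    rw [← hsmul C hμC, map_smul, smul_eq_mul, mul_comm]
    exact mul_le_mul_of_nonneg_right h3.le measureReal_nonneg
  rw [← hsmul B hμB, map_smul, smul_eq_mul, mul_comm] at hle
  exact absurd (le_of_mul_le_mul_right hle (hpos B hμB)) (not_le.2 hα)

variable [IsScalarTower ℝ 𝕜 Y] [CompleteSpace Y]

/-- The density takes on each piece of an exhaustion the value that nearly equals all averages of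
`T` there. -/
lemma HasRNP.exists_norm_sub_integralOperator_le (hY : HasRNP Y) (T : Lp 𝕜 1 μ →L[𝕜] Y)
    {ε : ℝ} (hε : 0 < ε) : ∃ g : Lp Y ∞ μ, ‖T - integralOperator μ 𝕜 Y g‖ ≤ ε := by
  obtain ⟨S, hSc, hSP, hSd, hS0⟩ := exists_countable_pairwiseDisjoint (μ := μ)
    (P := fun B => ∃ y : Y, ∀ C ⊆ B, MeasurableSet C →
      ‖operatorMeasure T C - μ.real C • y‖ ≤ ε * μ.real C)
    (fun A hA hμA => hY.exists_subset_operatorMeasure_sub_le T hε hA hμA)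
  choose! y hy using fun B hB => (hSP B hB).2.2
  have hyb : ∀ B ∈ S, ‖y B‖ ≤ ‖T‖ + ε := by
    intro B hB
    have hpos : 0 < μ.real B := ENNReal.toReal_pos (hSP B hB).2.1 (measure_ne_top _ _)
    have h1 := hy B hB B subset_rfl (hSP B hB).1
    have h2 := norm_operatorMeasure_le T B
    have h3 := norm_sub_norm_le (μ.real B • y B) (operatorMeasure T B)
    rw [norm_sub_rev, norm_smul, Real.norm_of_nonneg hpos.le] at h3
    nlinarith
  classical
  let g : Ω → Y := fun t => if h : ∃ B ∈ S, t ∈ B then y h.choose else 0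
  have hg : ∀ B ∈ S, ∀ t ∈ B, g t = y B := by
    intro B hB t ht
    have h : ∃ B ∈ S, t ∈ B := ⟨B, hB, ht⟩
    simp only [g, dif_pos h]
    congr 1
    exact hSd.elim h.choose_spec.1 hB (not_disjoint_iff.2 ⟨t, h.choose_spec.2, ht⟩)
  have hgb : ∀ t, ‖g t‖ ≤ ‖T‖ + ε := by
    intro t
    by_cases h : ∃ B ∈ S, t ∈ B
    · obtain ⟨B, hB, ht⟩ := h
      rw [hg B hB t ht]
      exact hyb B hB
    · simp only [g, dif_neg h, norm_zero]
      positivity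
  have hgm : AEStronglyMeasurable g μ := by
    have : Countable S := hSc.to_subtype
    have h1 : AEStronglyMeasurable g (μ.restrict (⋃ B : S, (B : Set Ω))) := by
      refine aestronglyMeasurable_iUnion_iff.2 fun B => ?_
      refine (aestronglyMeasurable_const (b := y B)).congr ?_
      filter_upwards [ae_restrict_mem (hSP B B.2).1] with t ht
      exact (hg B B.2 t ht).symm
    rw [← biUnion_eq_iUnion S fun B _ => B] at h1
    rwa [Measure.restrict_eq_self_of_ae_mem (show ∀ᵐ t ∂μ, t ∈ ⋃ B ∈ S, B from hS0)] at h1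
  have hgL : MemLp g ∞ μ := memLp_top_of_bound hgm _ (ae_of_all _ hgb)
  refine ⟨hgL.toLp, ContinuousLinearMap.opNorm_le_bound _ hε.le ?_⟩
  refine norm_apply_le_of_exists_subset _ fun A hA hμA => ?_
  obtain ⟨B, hB, hμ⟩ : ∃ B ∈ S, μ (A ∩ B) ≠ 0 := by
    by_contra! hcon
    refine hμA ?_
    rw [← measure_inter_conull hS0, inter_iUnion₂]
    exact (measure_biUnion_null_iff hSc).2 hcon
  have hAB := hA.inter (hSP B hB).1
  refine ⟨A ∩ B, inter_subset_left, hAB, hμ, ?_⟩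
  have h1 := hy B hB (A ∩ B) inter_subset_right hAB
  -- As the density is a.e. constant on `B`, the oscillation is `0` and its integral is exactly
  -- `μ.real (A ∩ B) • y B`.
  have h2 := norm_operatorMeasure_integralOperator_sub_le (𝕜 := 𝕜) hgL.toLp hAB (y := y B) (δ := 0)
    (by
      filter_upwards [hgL.coeFn_toLp] with t ht htB
      rw [ht, hg B hB t htB.2, sub_self, norm_zero])
  rw [zero_mul, norm_le_zero_iff, sub_eq_zero] at h2
  have h3 : operatorMeasure (T - integralOperator μ 𝕜 Y hgL.toLp) (A ∩ B) =
      operatorMeasure T (A ∩ B) - operatorMeasure (integralOperator μ 𝕜 Y hgL.toLp) (A ∩ B) := rfl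
  rwa [h3, h2]

/-- In a space with the Radon-Nikodým property, every operator on `L₁(μ)` is representable. -/
theorem HasRNP.isRepresentable (hY : HasRNP Y) (T : Lp 𝕜 1 μ →L[𝕜] Y) : IsRepresentable T := by
  have hclosed : IsClosed (range (integralOperator μ 𝕜 Y)) :=
    (AddMonoidHomClass.isometry_of_norm (integralOperator μ 𝕜 Y)
      norm_integralOperator).isClosedEmbedding.isClosed_range
  refine isRepresentable_iff.2 (hclosed.closure_subset (Metric.mem_closure_iff.2 fun ε hε => ?_))
  obtain ⟨g, hg⟩ := hY.exists_norm_sub_integralOperator_le T (half_pos hε)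
  exact ⟨_, mem_range_self g, by rw [dist_eq_norm]; linarith⟩

end RadonNikodym

end GeneratingOperators

theorem theorem4p9 {Ω : Type*} [MeasurableSpace Ω] (μ : Measure Ω)
    (𝕜 : Type*) [RCLike 𝕜]
    (Y : Type*) [NormedAddCommGroup Y] [NormedSpace ℝ Y] [NormedSpace 𝕜 Y]
    [IsScalarTower ℝ 𝕜 Y] [CompleteSpace Y] [Nontrivial Y] :
    (IsFiniteMeasure μ → μ ≠ 0 →
      GeneratingOperators.representableBall μ 𝕜 Y ⊆
          closure (convexHull ℝ (GeneratingOperators.Gen 𝕜 (Lp 𝕜 1 μ) Y)) ∧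
      (GeneratingOperators.HasRNP Y →
        closedBall (0 : Lp 𝕜 1 μ →L[𝕜] Y) 1 =
          closure (convexHull ℝ (GeneratingOperators.Gen 𝕜 (Lp 𝕜 1 μ) Y)))) ∧
    closedBall (0 : Lp Y ∞ μ) 1 =
      closure (convexHull ℝ {g : Lp Y ∞ μ | ∀ᵐ t ∂μ, ‖g t‖ = 1}) := by
  refine ⟨fun _ hμ => ?_, GeneratingOperators.closedBall_Lp_top_eq_closure_convexHull μ Y⟩
  have hrep := GeneratingOperators.representableBall_subset_closure_convexHull_Gen
    (𝕜 := 𝕜) (Y := Y) hμ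
  refine ⟨hrep, fun hY => subset_antisymm (fun T hT => hrep ⟨?_, hY.isRepresentable T⟩)
    (GeneratingOperators.closure_convexHull_Gen_subset_closedBall μ 𝕜 Y)⟩
  rwa [mem_closedBall_zero_iff] at hT
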